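/- Let $(r_n)_{n\ge0}$, $(q_n)_{n\ge0}$ be real sequences with $r_n>0$ for all $n$, let $(\sigma_n)_{n\ge0}$ be a complex sequence, and write $\Delta a_n=a_{n+1}-a_n$. Consider the equations $$\text{(i)}\ \ \Delta(r_{n-1}\Delta y_{n-1})=(q_n+\sigma_n)y_n,\qquad \text{(ii)}\ \ \Delta(r_{n-1}\Delta z_{n-1})=q_nz_n ,\qquad n\ge1,$$ for sequences indexed by $n\ge 0$. Assume that (ii) is non-oscillating, with a principal solution $(u_n)_{n\ge0}$ and a non-principal solution $(v_n)_{n\ge0}$ such that $u_n>0$, $v_n>0$ and $r_n(v_{n+1}u_n-u_{n+1}v_n)=1$ for all $n\ge0$, and $$\lim_{n\to\infty}\frac{u_n}{v_n}=0,\qquad \sum_{n=0}^\infty\frac1{r_nu_nu_{n+1}}=\infty,\qquad \sum_{n=0}^\infty\frac1{r_nv_nv_{n+1}}<\infty .$$ Suppose that the series $J=\sum_{n=0}^\infty\sigma_nu_nv_n$ converges (at least conditionally). Put $$J_m=\sum_{k=m}^\infty\sigma_ku_kv_k,\qquad A_n=\sup_{m\ge n}|J_m|,\qquad C_n=\frac{v_n}{u_n}\sum_{k=n}^\infty\sigma_ku_k^2$$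 (the convergence of $J$ implies that the last series converges, at least conditionally), and suppose that $$\sum_{n=0}^\infty\frac{A_{n+1}|C_{n+1}|}{r_nu_nv_{n+1}}<\infty .$$ Then the Hartman–Wintner problem is solvable: equation (i) has a fundamental system of (complex) solutions $(\tilde u_n)_{n\ge0}$, $(\tilde v_n)_{n\ge0}$ such that $$\lim_{n\to\infty}\frac{\tilde u_n}{u_n}=\lim_{n\to\infty}\frac{\tilde v_n}{v_n}=1,$$ $$\frac{\tilde u_{n+1}}{\tilde u_n}=\frac{u_{n+1}}{u_n}+o\Big(\frac1{r_nu_nv_n}\Big),\qquad \frac{\tilde v_{n+1}}{\tilde v_n}=\frac{v_{n+1}}{v_n}+o\Big(\frac1{r_nu_nv_n}\Big)\qquad(n\to\infty).$$ -/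

import Mathlib

namespace HartmanWintner

open Filter Topology Asymptotics SummationFilter

/-- `y` solves the second order difference equation `Δ(r_{n-1} Δ y_{n-1}) = p_n y_n`.  For sequences
indexed by `n ≥ 0` this is the equation at all indices `n + 1`, `n ≥ 0` (the index `0` would involve
`r_{-1}` and `y_{-1}`, and for any `r_{-1} ≠ 0` it merely determines `y_{-1}`). -/
def IsSolution {𝕜 : Type*} [Field 𝕜] (r p y : ℕ → 𝕜) : Prop :=
  ∀ n : ℕ, fwdDiff 1 (fun k => r k * fwdDiff 1 y k) n = p (n + 1) * y (n + 1)

/-- `u` is a principal and `v` a non-principal solution of `Δ(r_{n-1} Δ z_{n-1}) = q_n z_n`,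
both positive, normalized by `r_n (v_{n+1} u_n - u_{n+1} v_n) = 1`. -/
structure IsPrincipalPair (r q u v : ℕ → ℝ) : Prop where
  solution_u : IsSolution r q u
  solution_v : IsSolution r q v
  pos_u : ∀ n, 0 < u n
  pos_v : ∀ n, 0 < v n
  casoratian : ∀ n, r n * (v (n + 1) * u n - u (n + 1) * v n) = 1
  tendsto_ratio : Tendsto (fun n => u n / v n) atTop (𝓝 0)
  diverges_u : ¬ Summable (fun n => 1 / (r n * u n * u (n + 1)))
  converges_v : Summable (fun n => 1 / (r n * v n * v (n + 1)))

/-- `y, z` is a fundamental system of complex solutions of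
`Δ(r_{n-1} Δ y_{n-1}) = (q_n + σ_n) y_n`. -/
structure IsFundamentalSystem (r q : ℕ → ℝ) (σ y z : ℕ → ℂ) : Prop where
  solution_fst : IsSolution (fun n => (r n : ℂ)) (fun n => (q n : ℂ) + σ n) y
  solution_snd : IsSolution (fun n => (r n : ℂ)) (fun n => (q n : ℂ) + σ n) z
  independent : LinearIndependent ℂ ![y, z]

/-- Solvability of the Hartman–Wintner problem. -/
def IsSolvable (r q u v : ℕ → ℝ) (σ : ℕ → ℂ) : Prop :=
  ∃ u' v' : ℕ → ℂ, IsFundamentalSystem r q σ u' v' ∧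
    Tendsto (fun n => u' n / (u n : ℂ)) atTop (𝓝 1) ∧
    Tendsto (fun n => v' n / (v n : ℂ)) atTop (𝓝 1) ∧
    (fun n => u' (n + 1) / u' n - (u (n + 1) : ℂ) / (u n : ℂ))
      =o[atTop] (fun n => 1 / (r n * u n * v n)) ∧
    (fun n => v' (n + 1) / v' n - (v (n + 1) : ℂ) / (v n : ℂ))
      =o[atTop] (fun n => 1 / (r n * u n * v n))

/-- The series `J = ∑ σ_n u_n v_n` converges, at least conditionally: its partial sums have a
limit in `ℂ`. -/
def ConvergesJ (u v : ℕ → ℝ) (σ : ℕ → ℂ) : Prop :=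
  Summable (fun k => σ k * (u k : ℂ) * (v k : ℂ)) (conditional ℕ)

/-- `J_m = ∑_{k ≥ m} σ_k u_k v_k`, as a limit of partial sums. -/
noncomputable def J (u v : ℕ → ℝ) (σ : ℕ → ℂ) (m : ℕ) : ℂ :=
  ∑'[conditional ℕ] k : ℕ, σ (m + k) * (u (m + k) : ℂ) * (v (m + k) : ℂ)

/-- `A_n = sup_{m ≥ n} |J_m|`. -/
noncomputable def A (u v : ℕ → ℝ) (σ : ℕ → ℂ) (n : ℕ) : ℝ :=
  ⨆ k : ℕ, ‖J u v σ (n + k)‖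

/-- `C_n = (v_n / u_n) ∑_{k ≥ n} σ_k u_k ^ 2`, the series being a limit of partial sums. -/
noncomputable def C (u v : ℕ → ℝ) (σ : ℕ → ℂ) (n : ℕ) : ℂ :=
  (v n : ℂ) / (u n : ℂ) * ∑'[conditional ℕ] k : ℕ, σ (n + k) * (u (n + k) : ℂ) ^ 2

end HartmanWintner

namespace HartmanWintner

open Filter Topology Asymptotics SummationFilter Finset

/-! Put `h = v / u`, `y = u w` and `g = Δw / Δh`: (i) becomes `Δw = Δh g`, `Δg_n = s_{n+1} w_{n+1}`
with `s = σ u²`. Abel summation gives tails `S_n = ∑_{k≥n} s_k` with `h |S| ≤ 2A`, and `T = J - h S`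
satisfies `ΔT_n = -Δh_n S_{n+1}`, `|T| ≤ 3A`. In the variables `p_n = g_n + S_{n+1} w_n`, `ω = (1 -
T) w` the terms linear in `S` alone cancel; what remains is of size `A |S| Δh`, summable because
that is exactly the assumed series. Solutions with `ω_N = 1`, `p_N = 0` obey bounds uniform in `N`
(`IsSystem.bounds`); compactness yields `w → 1`, `h g → 0` (`IsSystem.exists_tendsto_one`).
Reduction of order gives the second solution, `x ~ h` (`IsSystem.exists_tendsto_div`). -/

/-! ### The first order system -/

/-- First order form of the equation: `g = Δw / Δh` and `Δg_n = s_{n+1} w_{n+1}`. -/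
structure IsSystem (h : ℕ → ℝ) (s w g : ℕ → ℂ) : Prop where
  step_fst : ∀ n, w (n + 1) = w n + (h (n + 1) - h n : ℝ) * g n
  step_snd : ∀ n, g (n + 1) = g n + s (n + 1) * w (n + 1)

/-- The recursion also runs backwards explicitly: `g N` is recovered from the values at `N + 1`,
then `w N`, with no division. -/
theorem IsSystem.exists_of_value (h : ℕ → ℝ) (s : ℕ → ℂ) (N : ℕ) :
    ∀ a b : ℂ, ∃ w g, IsSystem h s w g ∧ w N = a ∧ g N = b := by
  induction N with
  | zero =>
    intro a b
    let F : ℕ → ℂ × ℂ := fun n => Nat.rec (a, b) (fun n z =>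
      (z.1 + (h (n + 1) - h n : ℝ) * z.2,
        z.2 + s (n + 1) * (z.1 + (h (n + 1) - h n : ℝ) * z.2))) n
    exact ⟨fun n => (F n).1, fun n => (F n).2, ⟨fun _ => rfl, fun _ => rfl⟩, rfl, rfl⟩
  | succ N ih =>
    intro a b
    obtain ⟨w, g, hs, hw, hg⟩ :=
      ih (a - (h (N + 1) - h N : ℝ) * (b - s (N + 1) * a)) (b - s (N + 1) * a)
    have h1 : w (N + 1) = a := by rw [hs.step_fst, hw, hg]; ring
    exact ⟨w, g, hs, h1, by rw [hs.step_snd, h1, hg]; ring⟩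

theorem IsSystem.tendsto_of_tendsto {h : ℕ → ℝ} {s w g : ℕ → ℂ} {w' g' : ℕ → ℕ → ℂ}
    (hs : IsSystem h s w g) (hs' : ∀ i, IsSystem h s (w' i) (g' i)) {m : ℕ}
    (hw : Tendsto (fun i => w' i m) atTop (𝓝 (w m)))
    (hg : Tendsto (fun i => g' i m) atTop (𝓝 (g m))) {n : ℕ} (hn : m ≤ n) :
    Tendsto (fun i => w' i n) atTop (𝓝 (w n)) ∧ Tendsto (fun i => g' i n) atTop (𝓝 (g n)) := by
  induction n, hn using Nat.le_induction with
  | base => exact ⟨hw, hg⟩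
  | succ n _ ih =>
    have h1 : Tendsto (fun i => w' i (n + 1)) atTop (𝓝 (w (n + 1))) := by
      simp only [(hs' _).step_fst, hs.step_fst]
      exact ih.1.add (ih.2.const_mul _)
    refine ⟨h1, ?_⟩
    simp only [(hs' _).step_snd, hs.step_snd]
    exact ih.2.add (h1.const_mul _)

theorem IsSystem.casoratian {h : ℕ → ℝ} {s w g x f : ℕ → ℂ} (hw : IsSystem h s w g)
    (hx : IsSystem h s x f) (n : ℕ) : w n * f n - x n * g n = w 0 * f 0 - x 0 * g 0 := by
  induction n with
  | zero => rfl
  | succ n ih =>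
    rw [← ih, hw.step_snd, hx.step_snd, hw.step_fst, hx.step_fst]
    ring

/-! ### A priori estimates from terminal data -/

/-- Multiply `|p_k| ≤ |Δp_k| + |p_{k+1}|` by `h_{k+1} = h_k + Δh_k` and telescope back from `N`. The
extra sum on the left later absorbs the part of `Δp` proportional to `p`. -/
theorem weighted_norm_add_sum_le {h : ℕ → ℝ} (hpos : ∀ n, 0 < h n) {p : ℕ → ℂ} {N : ℕ}
    (hN : p N = 0) {n : ℕ} (hn : n ≤ N) :
    h n * ‖p n‖ + ∑ k ∈ Ico n N, (h (k + 1) - h k) * ‖p k‖ ≤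
      ∑ k ∈ Ico n N, h (k + 1) * ‖p (k + 1) - p k‖ := by
  induction hn using Nat.decreasingInduction with
  | self => simp [hN]
  | of_succ k hk ih =>
    rw [sum_eq_sum_Ico_succ_bot hk, sum_eq_sum_Ico_succ_bot hk]
    have h1 : ‖p k‖ ≤ ‖p (k + 1) - p k‖ + ‖p (k + 1)‖ := by
      have := norm_sub_le (p (k + 1)) (p (k + 1) - p k)
      rw [sub_sub_cancel] at this
      linarith
    have := mul_le_mul_of_nonneg_left h1 (hpos (k + 1)).le
    linarith

/-- Estimates for the solution with prescribed terminal values at `N`, uniform in `N`. -/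
theorem IsSystem.bounds {h : ℕ → ℝ} (hpos : ∀ n, 0 < h n) (hmono : StrictMono h)
    {S T w g : ℕ → ℂ} {A E : ℕ → ℝ} {m N : ℕ}
    (hsys : IsSystem h (fun n => S n - S (n + 1)) w g)
    (hST : ∀ n, T (n + 1) = T n - (h (n + 1) - h n : ℝ) * S (n + 1))
    (hT : ∀ n, ‖T n‖ ≤ 3 * A n) (hS : ∀ n, h n * ‖S n‖ ≤ 2 * A n)
    (hA : ∀ n, m ≤ n → A n ≤ 1 / 8)
    (hE : ∀ n, m ≤ n → n ≤ N →
      ∑ k ∈ Ico n N, A (k + 1) * ‖S (k + 1)‖ * (h (k + 1) - h k) ≤ E n)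
    (hE' : ∀ n, m ≤ n → E n ≤ 1 / 36)
    (hwN : (1 - T N) * w N = 1) (hgN : g N = - (S (N + 1) * w N))
    {n : ℕ} (hmn : m ≤ n) (hnN : n ≤ N) :
    ‖(1 - T n) * w n - 1‖ ≤ 36 * E n ∧ h n * ‖g n + S (n + 1) * w n‖ ≤ 16 * E n ∧
      ‖w n‖ ≤ 4 := by
  set p : ℕ → ℂ := fun n => g n + S (n + 1) * w n with hp
  set ω : ℕ → ℂ := fun n => (1 - T n) * w n with hω
  have hd : ∀ n, 0 ≤ h (n + 1) - h n := fun n => sub_nonneg.2 (hmono (Nat.lt_succ_self n)).le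
  have hA0 : ∀ n, 0 ≤ A n := fun n => by linarith [norm_nonneg (T n), hT n]
  have hE0 : ∀ n, m ≤ n → n ≤ N → 0 ≤ E n := fun n h1 h2 =>
    (sum_nonneg fun k _ => mul_nonneg (mul_nonneg (hA0 _) (norm_nonneg _)) (hd k)).trans (hE n h1 h2)
  have hpN : p N = 0 := by simp [hp, hgN]
  have hdp : ∀ k, p (k + 1) - p k =
      S (k + 1) * (h (k + 1) - h k : ℝ) * (p k - S (k + 1) * w k) := fun k => by
    simp only [hp, hsys.step_snd, hsys.step_fst]; ring
  have hdω : ∀ k, ω (k + 1) - ω k = (1 - T (k + 1)) * ((h (k + 1) - h k : ℝ) * p k) +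
      T (k + 1) * (S (k + 1) * (h (k + 1) - h k : ℝ) * w k) := fun k => by
    simp only [hp, hω, hsys.step_fst, hST]; ring
  have hwω : ∀ k, m ≤ k → ‖w k‖ ≤ 2 * ‖ω k‖ := fun k hk => by
    have h1 : (1 : ℝ) / 2 ≤ ‖1 - T k‖ := by
      have := norm_sub_norm_le (1 : ℂ) (T k)
      rw [norm_one] at this
      linarith [hT k, hA k hk]
    simp only [hω, norm_mul]
    nlinarith [norm_nonneg (w k)]
  -- All errors are bounded linearly in the maximum `M` of `|ω|`, which is itself bounded only
  -- afterwards.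
  obtain ⟨i, hi, hmax⟩ := exists_max_image (Icc m N) (fun k => ‖ω k‖) ⟨n, by simp [hmn, hnN]⟩
  set M := ‖ω i‖
  have hM0 : 0 ≤ M := norm_nonneg _
  rw [mem_Icc] at hi
  have hwM : ∀ k, m ≤ k → k ≤ N → ‖w k‖ ≤ 2 * M := fun k h1 h2 =>
    (hwω k h1).trans (by linarith [hmax k (by simp [h1, h2])])
  have hpb : ∀ n, m ≤ n → n ≤ N →
      h n * ‖p n‖ + 1 / 2 * ∑ k ∈ Ico n N, (h (k + 1) - h k) * ‖p k‖ ≤ 4 * M * E n := by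
    intro n h1 h2
    -- Since `h |S| ≤ 2A ≤ 1/4`, the `p` term takes at most half of the sum on the left of
    -- `weighted_norm_add_sum_le`.
    have key : ∑ k ∈ Ico n N, h (k + 1) * ‖p (k + 1) - p k‖ ≤
        ∑ k ∈ Ico n N, (1 / 2 * ((h (k + 1) - h k) * ‖p k‖) +
          4 * M * (A (k + 1) * ‖S (k + 1)‖ * (h (k + 1) - h k))) := by
      refine sum_le_sum fun k hk => ?_
      rw [mem_Ico] at hk
      have e1 : ‖p (k + 1) - p k‖ ≤
          ‖S (k + 1)‖ * (h (k + 1) - h k) * (‖p k‖ + ‖S (k + 1)‖ * (2 * M)) := by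
        rw [hdp, norm_mul, norm_mul, Complex.norm_real, Real.norm_of_nonneg (hd k)]
        refine mul_le_mul_of_nonneg_left ?_ (mul_nonneg (norm_nonneg _) (hd k))
        refine (norm_sub_le _ _).trans ?_
        rw [norm_mul]
        gcongr
        exact hwM k (by omega) (by omega)
      have e2 := mul_le_mul_of_nonneg_left e1 (hpos (k + 1)).le
      have e3 : 0 ≤ (h (k + 1) - h k) * (‖p k‖ + ‖S (k + 1)‖ * (2 * M)) := by
        have := hd k
        positivity
      have e4 := mul_le_mul_of_nonneg_right (hS (k + 1)) e3
      have e5 := mul_le_mul_of_nonneg_right (hA (k + 1) (by omega))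
        (mul_nonneg (hd k) (norm_nonneg (p k)))
      have e6 := mul_nonneg (hd k) (norm_nonneg (p k))
      linarith
    rw [sum_add_distrib, ← mul_sum, ← mul_sum] at key
    have h3 := weighted_norm_add_sum_le hpos hpN h2
    have h4 := mul_le_mul_of_nonneg_left (hE n h1 h2) (by positivity : 0 ≤ 4 * M)
    linarith
  -- `18 = 12 + 6`: `3/2` times `∑ Δh |p| ≤ 8 M E`, plus `3A · 2M` from the `T S w` term.
  have hωb : ∀ n, m ≤ n → n ≤ N → ‖ω n - 1‖ ≤ 18 * M * E n := by
    intro n h1 h2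
    have h3 := dist_le_Ico_sum_dist ω h2
    rw [show ω N = 1 from hwN, dist_eq_norm] at h3
    have key : ∑ k ∈ Ico n N, dist (ω k) (ω (k + 1)) ≤
        ∑ k ∈ Ico n N, (3 / 2 * ((h (k + 1) - h k) * ‖p k‖) +
          6 * M * (A (k + 1) * ‖S (k + 1)‖ * (h (k + 1) - h k))) := by
      refine sum_le_sum fun k hk => ?_
      rw [mem_Ico] at hk
      rw [dist_comm, dist_eq_norm, hdω]
      have e0 : ‖1 - T (k + 1)‖ ≤ 3 / 2 := by
        have := norm_sub_le (1 : ℂ) (T (k + 1))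
        rw [norm_one] at this
        linarith [hT (k + 1), hA (k + 1) (by omega)]
      have e1 : ‖(1 - T (k + 1)) * ((h (k + 1) - h k : ℝ) * p k)‖ ≤
          3 / 2 * ((h (k + 1) - h k) * ‖p k‖) := by
        rw [norm_mul, norm_mul, Complex.norm_real, Real.norm_of_nonneg (hd k)]
        exact mul_le_mul_of_nonneg_right e0 (mul_nonneg (hd k) (norm_nonneg _))
      have e2 : ‖T (k + 1) * (S (k + 1) * (h (k + 1) - h k : ℝ) * w k)‖ ≤
          3 * A (k + 1) * (‖S (k + 1)‖ * (h (k + 1) - h k) * (2 * M)) := by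
        rw [norm_mul, norm_mul, norm_mul, Complex.norm_real, Real.norm_of_nonneg (hd k)]
        have := hd k
        have := hA0 (k + 1)
        gcongr
        · exact hT _
        · exact hwM k (by omega) (by omega)
      refine (norm_add_le _ _).trans ?_
      linarith
    rw [sum_add_distrib, ← mul_sum, ← mul_sum] at key
    have h4 := mul_le_mul_of_nonneg_left (hE n h1 h2) (by positivity : 0 ≤ 6 * M)
    have h5 := hpb n h1 h2
    have h6 := mul_nonneg (hpos n).le (norm_nonneg (p n))
    linarith
  -- With `E ≤ 1/36` this reads `M ≤ M/2 + 1`.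
  have hM : M ≤ 2 := by
    have h1 := hωb i hi.1 hi.2
    have h2 : M ≤ ‖ω i - 1‖ + 1 := by
      have := norm_add_le (ω i - 1) 1
      rwa [sub_add_cancel, norm_one] at this
    have h3 := mul_le_mul_of_nonneg_left (hE' i hi.1) hM0
    linarith
  have hEn := hE0 n hmn hnN
  have hME := mul_le_mul_of_nonneg_right hM hEn
  refine ⟨(hωb n hmn hnN).trans (by linarith), ?_, (hwM n hmn hnN).trans (by linarith)⟩
  have h1 := hpb n hmn hnN
  have h2 : 0 ≤ ∑ k ∈ Ico n N, (h (k + 1) - h k) * ‖p k‖ :=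
    sum_nonneg fun k _ => mul_nonneg (hd k) (norm_nonneg _)
  change h n * ‖p n‖ ≤ _
  linarith

/-! ### Compactness: the solution asymptotic to `1` -/

/-- Existence of a solution asymptotic to `1`. -/
theorem IsSystem.exists_tendsto_one {h : ℕ → ℝ} (hpos : ∀ n, 0 < h n) (hmono : StrictMono h)
    {S T : ℕ → ℂ} {A : ℕ → ℝ}
    (hST : ∀ n, T (n + 1) = T n - (h (n + 1) - h n : ℝ) * S (n + 1))
    (hT : ∀ n, ‖T n‖ ≤ 3 * A n) (hS : ∀ n, h n * ‖S n‖ ≤ 2 * A n)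
    (hA : Tendsto A atTop (𝓝 0))
    (hsum : Summable fun n => A (n + 1) * ‖S (n + 1)‖ * (h (n + 1) - h n)) :
    ∃ w g, IsSystem h (fun n => S n - S (n + 1)) w g ∧ Tendsto w atTop (𝓝 1) ∧
      Tendsto (fun n => (h n : ℂ) * g n) atTop (𝓝 0) := by
  set a : ℕ → ℝ := fun n => A (n + 1) * ‖S (n + 1)‖ * (h (n + 1) - h n) with ha
  set E : ℕ → ℝ := fun n => ∑' k, a (k + n) with hEdef
  have hd : ∀ n, 0 ≤ h (n + 1) - h n := fun n => sub_nonneg.2 (hmono (Nat.lt_succ_self n)).le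
  have hA0 : ∀ n, 0 ≤ A n := fun n => by linarith [norm_nonneg (T n), hT n]
  have ha0 : ∀ n, 0 ≤ a n := fun n => mul_nonneg (mul_nonneg (hA0 _) (norm_nonneg _)) (hd n)
  have hElim : Tendsto E atTop (𝓝 0) := tendsto_sum_nat_add a
  have hEsum : ∀ n N, ∑ k ∈ Ico n N, a k ≤ E n := by
    intro n N
    rw [sum_Ico_eq_sum_range]
    simp only [add_comm n]
    exact ((summable_nat_add_iff n).2 hsum).sum_le_tsum _ fun k _ => ha0 _
  obtain ⟨m, hm⟩ := eventually_atTop.1 ((hA.eventually_le_const (by norm_num : (0 : ℝ) < 1 / 8)).and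
    (hElim.eventually_le_const (by norm_num : (0 : ℝ) < 1 / 36)))
  have hTne : ∀ n, m ≤ n → 1 - T n ≠ 0 := by
    intro n hn h0
    have h1 := hT n
    rw [← sub_eq_zero.1 h0, norm_one] at h1
    linarith [(hm n hn).1]
  -- These terminal values encode `ω_N = 1` and `p_N = 0`.
  choose W G hWG hWN hGN using fun N => IsSystem.exists_of_value h (fun n => S n - S (n + 1)) N
    (1 - T N)⁻¹ (-(S (N + 1) * (1 - T N)⁻¹))
  have hb : ∀ N n, m ≤ n → n ≤ N → ‖(1 - T n) * W N n - 1‖ ≤ 36 * E n ∧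
      h n * ‖G N n + S (n + 1) * W N n‖ ≤ 16 * E n ∧ ‖W N n‖ ≤ 4 := by
    intro N n h1 h2
    refine (hWG N).bounds hpos hmono hST hT hS (fun n hn => (hm n hn).1)
      (fun n _ _ => hEsum n N) (fun n hn => (hm n hn).2) ?_ ?_ h1 h2
    · rw [hWN, mul_inv_cancel₀ (hTne N (h1.trans h2))]
    · rw [hGN, hWN]
  -- Boundedness at the single index `m` suffices: the recursion carries a convergent subsequence to
  -- all later indices.
  obtain ⟨R, hR⟩ : ∃ R, ∀ N, (W (m + N) m, G (m + N) m) ∈ Metric.closedBall (0 : ℂ × ℂ) R := by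
    refine ⟨max 4 (16 * E m / h m + ‖S (m + 1)‖ * 4), fun N => ?_⟩
    obtain ⟨-, h2, h3⟩ := hb (m + N) m le_rfl (by omega)
    rw [mem_closedBall_zero_iff, Prod.norm_mk]
    refine max_le_max h3 ?_
    have h4 : ‖G (m + N) m + S (m + 1) * W (m + N) m‖ ≤ 16 * E m / h m := by
      rw [le_div_iff₀ (hpos m)]; linarith
    have h5 := norm_sub_le (G (m + N) m + S (m + 1) * W (m + N) m) (S (m + 1) * W (m + N) m)
    rw [add_sub_cancel_right, norm_mul] at h5
    have h6 := mul_le_mul_of_nonneg_left h3 (norm_nonneg (S (m + 1)))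
    linarith
  obtain ⟨z, -, φ, hφ, hlim⟩ := tendsto_subseq_of_bounded Metric.isBounded_closedBall hR
  obtain ⟨w, g, hwg, hw, hg⟩ := IsSystem.exists_of_value h (fun n => S n - S (n + 1)) m z.1 z.2
  have hconv : ∀ n, m ≤ n → Tendsto (fun i => W (m + φ i) n) atTop (𝓝 (w n)) ∧
      Tendsto (fun i => G (m + φ i) n) atTop (𝓝 (g n)) := fun n hn =>
    hwg.tendsto_of_tendsto (fun i => hWG (m + φ i))
      (by rw [hw]; exact (continuous_fst.tendsto z).comp hlim)
      (by rw [hg]; exact (continuous_snd.tendsto z).comp hlim) hn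
  have hev : ∀ n, ∀ᶠ i in atTop, n ≤ m + φ i := fun n =>
    (eventually_ge_atTop n).mono fun i hi => hi.trans ((hφ.id_le i).trans (Nat.le_add_left _ _))
  have hωlim : ∀ n, m ≤ n → ‖(1 - T n) * w n - 1‖ ≤ 36 * E n := fun n hn =>
    le_of_tendsto (((hconv n hn).1.const_mul (1 - T n)).sub_const 1).norm
      ((hev n).mono fun i hi => (hb _ n hn hi).1)
  have hplim : ∀ n, m ≤ n → h n * ‖g n + S (n + 1) * w n‖ ≤ 16 * E n := fun n hn =>
    le_of_tendsto (((hconv n hn).2.add ((hconv n hn).1.const_mul (S (n + 1)))).norm.const_mul _)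
      ((hev n).mono fun i hi => (hb _ n hn hi).2.1)
  have hTlim : Tendsto T atTop (𝓝 0) :=
    squeeze_zero_norm hT (by simpa using hA.const_mul 3)
  have hwlim : Tendsto w atTop (𝓝 1) := by
    have h1 : Tendsto (fun n => (1 - T n) * w n - 1) atTop (𝓝 0) := by
      refine squeeze_zero_norm' ((eventually_ge_atTop m).mono hωlim) ?_
      simpa using hElim.const_mul 36
    have h2 : Tendsto (fun n => 1 - T n) atTop (𝓝 1) := by simpa using hTlim.const_sub 1
    have h3 : Tendsto (fun n => ((1 - T n) * w n - 1 + 1) / (1 - T n)) atTop (𝓝 ((0 + 1) / 1)) :=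
      (h1.add_const 1).div h2 one_ne_zero
    rw [zero_add, div_one] at h3
    refine h3.congr' ((eventually_ge_atTop m).mono fun n hn => ?_)
    rw [sub_add_cancel, mul_div_cancel_left₀ _ (hTne n hn)]
  refine ⟨w, g, hwg, hwlim, ?_⟩
  have h1 : Tendsto (fun n => (h n : ℂ) * (g n + S (n + 1) * w n)) atTop (𝓝 0) := by
    refine squeeze_zero_norm' ((eventually_ge_atTop m).mono fun n hn => ?_)
      (by simpa using hElim.const_mul 16)
    rw [norm_mul, Complex.norm_real, Real.norm_of_nonneg (hpos n).le]
    exact hplim n hn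
  have h2 : Tendsto (fun n => (h n : ℂ) * S (n + 1)) atTop (𝓝 0) := by
    have h3 : Tendsto (fun n => 2 * A (n + 1)) atTop (𝓝 0) := by
      simpa using (hA.comp (tendsto_add_atTop_nat 1)).const_mul 2
    refine squeeze_zero_norm (fun n => ?_) h3
    rw [norm_mul, Complex.norm_real, Real.norm_of_nonneg (hpos n).le]
    refine le_trans ?_ (hS (n + 1))
    exact mul_le_mul_of_nonneg_right (hmono (Nat.lt_succ_self n)).le (norm_nonneg _)
  have h3 := h1.sub (h2.mul hwlim)
  rw [zero_mul, sub_zero] at h3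
  exact h3.congr fun n => by ring

/-! ### Reduction of order -/

/-- Reduction of order: a second solution, asymptotic to `h`. -/
theorem IsSystem.exists_tendsto_div {h : ℕ → ℝ} (hpos : ∀ n, 0 < h n) (hmono : StrictMono h)
    (htop : Tendsto h atTop atTop) {s w g : ℕ → ℂ} (hwg : IsSystem h s w g)
    (hw : Tendsto w atTop (𝓝 1)) (hg : Tendsto (fun n => (h n : ℂ) * g n) atTop (𝓝 0)) :
    ∃ x f, IsSystem h s x f ∧ Tendsto (fun n => x n / h n) atTop (𝓝 1) ∧
      Tendsto f atTop (𝓝 1) := by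
  have hhne : ∀ n, (h n : ℂ) ≠ 0 := fun n => Complex.ofReal_ne_zero.2 (hpos n).ne'
  obtain ⟨N, hN⟩ := eventually_atTop.1 (hw.eventually_ne one_ne_zero)
  -- Normalized to Casoratian `1` at an index beyond which `w` does not vanish.
  obtain ⟨x, f, hxf, hx, hf⟩ := IsSystem.exists_of_value h s N 0 (w N)⁻¹
  have hcas : ∀ n, w n * f n - x n * g n = 1 := by
    intro n
    rw [hwg.casoratian hxf, ← hwg.casoratian hxf N, hx, hf, mul_inv_cancel₀ (hN N le_rfl)]
    ring
  set Q : ℕ → ℂ := fun n => x n / w n with hQ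
  have hdQ : ∀ n, N ≤ n → Q (n + 1) - Q n = (h (n + 1) - h n : ℝ) * (1 / (w n * w (n + 1))) := by
    intro n hn
    have h1 := hN n hn
    have h2 := hN (n + 1) (by omega)
    rw [hQ]
    field_simp
    rw [hwg.step_fst, hxf.step_fst]
    linear_combination (h (n + 1) - h n : ℝ) * hcas n
  have hlo : (fun n => (Q (n + 1) - h (n + 1)) - (Q n - h n)) =o[atTop]
      fun n => h (n + 1) - h n := by
    have h1 : Tendsto (fun n => 1 / (w n * w (n + 1)) - 1) atTop (𝓝 0) := by
      have h2 := (tendsto_const_nhds (x := (1 : ℂ))).div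
        (hw.mul (hw.comp (tendsto_add_atTop_nat 1))) (by norm_num)
      simpa using h2.sub_const 1
    have h2 : (fun n => ((h (n + 1) - h n : ℝ) : ℂ) * (1 / (w n * w (n + 1)) - 1)) =o[atTop]
        fun n => (h (n + 1) - h n) * (1 : ℝ) := by
      refine IsBigO.mul_isLittleO ?_ ((isLittleO_one_iff ℝ).2 h1)
      exact isBigO_of_le _ fun n => by rw [Complex.norm_real]
    simp only [mul_one] at h2
    refine h2.congr' ((eventually_ge_atTop N).mono fun n hn => ?_) EventuallyEq.rfl
    have := hdQ n hn
    push_cast at this ⊢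
    linear_combination -this
  have htel : ∀ n, ∑ i ∈ range n, (h (i + 1) - h i) = h n - h 0 := fun n => sum_range_sub h n
  -- Stolz–Cesàro in little-o form: increments `o(Δh)` sum to `o(h)` as `h → ∞`.
  have hlo' := hlo.sum_range (fun n => sub_nonneg.2 (hmono (Nat.lt_succ_self n)).le)
    (by simp only [htel]; exact tendsto_atTop_add_const_right _ _ htop)
  simp only [htel] at hlo'
  have htel' : ∀ n, ∑ i ∈ range n, ((Q (i + 1) - h (i + 1)) - (Q i - h i)) =
      (Q n - h n) - (Q 0 - h 0) := fun n => sum_range_sub (fun n => Q n - h n) n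
  simp only [htel'] at hlo'
  have hhO : (fun n => h n - h 0) =O[atTop] h := IsBigO.of_norm_le fun n => by
    rw [Real.norm_of_nonneg (sub_nonneg.2 (hmono.monotone (Nat.zero_le n)))]
    linarith [hpos 0]
  have hQh : Tendsto (fun n => Q n / h n) atTop (𝓝 1) := by
    have hc : (fun _ : ℕ => Q 0 - (h 0 : ℂ)) =o[atTop] h :=
      isLittleO_const_left.2 (Or.inr (tendsto_norm_atTop_atTop.comp htop))
    have h1 := (hlo'.trans_isBigO hhO).add hc
    simp only [sub_add_cancel] at h1
    have h2 : (fun n => Q n - h n) =o[atTop] fun n => (h n : ℂ) :=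
      h1.trans_isBigO (isBigO_of_le _ fun n => by rw [Complex.norm_real])
    have h3 := h2.tendsto_div_nhds_zero.add_const 1
    rw [zero_add] at h3
    refine h3.congr fun n => ?_
    have := hhne n
    field_simp
    ring
  have hxh : Tendsto (fun n => x n / h n) atTop (𝓝 1) := by
    have h1 := hQh.mul hw
    rw [one_mul] at h1
    refine h1.congr' ((eventually_ge_atTop N).mono fun n hn => ?_)
    have := hhne n
    have := hN n hn
    simp only [hQ]
    field_simp
  refine ⟨x, f, hxf, hxh, ?_⟩
  -- The Casoratian gives `f = (1 + x g) / w`, and `x g = (x / h)(h g) → 0`.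
  have h1 := (((hxh.mul hg).const_add 1).div hw one_ne_zero)
  rw [mul_zero, add_zero, div_one] at h1
  refine h1.congr' ((eventually_ge_atTop N).mono fun n hn => ?_)
  have h2 := hhne n
  have h3 := hN n hn
  have h4 := hcas n
  simp only [Pi.div_apply]
  field_simp
  linear_combination -h4
-- Conditionally convergent sums and Abel summation
theorem hasSum_conditional_iff {f : ℕ → ℂ} {a : ℂ} :
    HasSum f a (conditional ℕ) ↔ Tendsto (fun n => ∑ k ∈ range n, f k) atTop (𝓝 a) := by
  rw [HasSum, conditional_filter_eq_map_range, tendsto_map'_iff]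
  rfl

theorem tsum_conditional_tail {f : ℕ → ℂ} {a : ℂ}
    (hf : Tendsto (fun n => ∑ k ∈ range n, f k) atTop (𝓝 a)) (n : ℕ) :
    ∑'[conditional ℕ] k, f (n + k) = a - ∑ k ∈ range n, f k := by
  refine HasSum.tsum_eq (hasSum_conditional_iff.2 ?_)
  have h := (hf.comp (tendsto_add_atTop_nat n)).sub_const (∑ k ∈ range n, f k)
  refine h.congr fun N => ?_
  rw [Function.comp_apply, add_comm N n, sum_range_add, add_sub_cancel_left]

/-- Abel summation with a decreasing factor. -/
theorem abel_summation {f j : ℕ → ℂ} {c A : ℕ → ℝ} (hc : Antitone c) (hc0 : ∀ n, 0 ≤ c n)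
    (hf : ∀ n, f n = (j n - j (n + 1)) * c n) (hj : Tendsto j atTop (𝓝 0))
    (hA : ∀ n m, n ≤ m → ‖j m‖ ≤ A n) :
    ∃ a, Tendsto (fun n => ∑ k ∈ range n, f k) atTop (𝓝 a) ∧
      ∀ n, ‖a - ∑ k ∈ range n, f k‖ ≤ 2 * A n * c n := by
  -- Adding the boundary term leaves increments `j_{m+1} Δc_m`, dominated by a telescoping sum;
  -- removing it again costs the second `A n * c n`.
  set x : ℕ → ℂ := fun n => ∑ k ∈ range n, f k + j n * c n with hx
  have hstep : ∀ n m, n ≤ m → dist (x m) (x (m + 1)) ≤ A n * c m - A n * c (m + 1) := by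
    intro n m hnm
    have h1 : x (m + 1) - x m = j (m + 1) * ((c (m + 1) - c m : ℝ) : ℂ) := by
      simp only [hx, sum_range_succ, hf]
      push_cast
      ring
    rw [dist_comm, dist_eq_norm, h1, norm_mul, Complex.norm_real, Real.norm_of_nonpos
      (sub_nonpos.2 (hc (Nat.le_succ m))), neg_sub, ← mul_sub]
    exact mul_le_mul_of_nonneg_right (hA n (m + 1) (by omega)) (sub_nonneg.2 (hc (Nat.le_succ m)))
  have hA0 : ∀ n, 0 ≤ A n := fun n => (norm_nonneg _).trans (hA n n le_rfl)
  have hbound : ∀ n m, n ≤ m → dist (x n) (x m) ≤ A n * c n := by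
    intro n m hnm
    have h1 : dist (x n) (x m) ≤ A n * c n - A n * c m := by
      induction m, hnm using Nat.le_induction with
      | base => simp
      | succ m hm ih =>
        have := dist_triangle (x n) (x m) (x (m + 1))
        linarith [hstep n m hm]
    linarith [mul_nonneg (hA0 n) (hc0 m)]
  have hjc : Tendsto (fun n => j n * (c n : ℂ)) atTop (𝓝 0) := by
    have h1 : Tendsto (fun n => ‖j n‖ * c 0) atTop (𝓝 0) := by
      simpa using hj.norm.mul_const (c 0)
    refine squeeze_zero_norm (fun n => ?_) h1
    rw [norm_mul, Complex.norm_real, Real.norm_of_nonneg (hc0 n)]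
    exact mul_le_mul_of_nonneg_left (hc (Nat.zero_le n)) (norm_nonneg _)
  have hsum : Summable fun m => A 0 * c m - A 0 * c (m + 1) := by
    refine summable_of_sum_range_le (c := A 0 * c 0)
      (fun m => dist_nonneg.trans (hstep 0 m (Nat.zero_le m))) fun n => ?_
    rw [sum_range_sub' (fun m => A 0 * c m)]
    linarith [mul_nonneg (hA0 0) (hc0 n)]
  obtain ⟨a, ha⟩ := cauchySeq_tendsto_of_complete
    (cauchySeq_of_dist_le_of_summable _ (fun m => hstep 0 m (Nat.zero_le m)) hsum)
  refine ⟨a, ?_, fun n => ?_⟩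
  · have := ha.sub hjc
    rw [sub_zero] at this
    exact this.congr fun n => add_sub_cancel_right _ _
  · have h1 : dist (x n) a ≤ A n * c n :=
      le_of_tendsto (tendsto_const_nhds.dist ha)
        ((eventually_ge_atTop n).mono fun m hm => hbound n m hm)
    rw [dist_comm, dist_eq_norm] at h1
    have h2 : a - ∑ k ∈ range n, f k = (a - x n) + j n * c n := by simp only [hx]; ring
    rw [h2]
    refine (norm_add_le _ _).trans ?_
    rw [norm_mul, Complex.norm_real, Real.norm_of_nonneg (hc0 n)]
    linarith [mul_le_mul_of_nonneg_right (hA n n le_rfl) (hc0 n)]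

/-! ### The tails `J_m` and their suprema -/

section tail

variable {u v : ℕ → ℝ} {σ : ℕ → ℂ}

theorem ConvergesJ.J_succ (hJ : ConvergesJ u v σ) (n : ℕ) :
    J u v σ n - J u v σ (n + 1) = σ n * (u n : ℂ) * (v n : ℂ) := by
  obtain ⟨a, ha⟩ := hJ
  have h := tsum_conditional_tail (hasSum_conditional_iff.1 ha)
  rw [J, J, h n, h (n + 1), sum_range_succ]
  ring

theorem ConvergesJ.tendsto_J (hJ : ConvergesJ u v σ) : Tendsto (J u v σ) atTop (𝓝 0) := by
  obtain ⟨a, ha⟩ := hJ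
  rw [hasSum_conditional_iff] at ha
  have h := ha.const_sub a
  rw [sub_self] at h
  exact h.congr fun n => (tsum_conditional_tail ha n).symm

theorem ConvergesJ.norm_J_le_A (hJ : ConvergesJ u v σ) {n m : ℕ} (h : n ≤ m) :
    ‖J u v σ m‖ ≤ A u v σ n := by
  obtain ⟨k, rfl⟩ := Nat.exists_eq_add_of_le h
  obtain ⟨B, hB⟩ := hJ.tendsto_J.norm.bddAbove_range
  exact le_ciSup (f := fun k => ‖J u v σ (n + k)‖)
    ⟨B, by rintro _ ⟨i, rfl⟩; exact hB ⟨n + i, rfl⟩⟩ k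

theorem ConvergesJ.tendsto_A (hJ : ConvergesJ u v σ) : Tendsto (A u v σ) atTop (𝓝 0) := by
  refine tendsto_order.2 ⟨fun b hb => Eventually.of_forall fun n =>
    hb.trans_le ((norm_nonneg _).trans (hJ.norm_J_le_A le_rfl)), fun b hb => ?_⟩
  have h1 := hJ.tendsto_J.norm
  rw [norm_zero] at h1
  obtain ⟨N, hN⟩ := eventually_atTop.1 (h1.eventually_le_const (half_pos hb))
  filter_upwards [eventually_ge_atTop N] with n hn
  exact (ciSup_le fun k => hN (n + k) (by omega)).trans_lt (half_lt_self hb)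

end tail

/-! ### The substitution `y = u w` -/

namespace IsPrincipalPair

variable {r q u v : ℕ → ℝ}

theorem r_ne_zero (huv : IsPrincipalPair r q u v) (n : ℕ) : r n ≠ 0 := fun h => by
  simpa [h] using huv.casoratian n

theorem div_succ_sub_div (huv : IsPrincipalPair r q u v) (n : ℕ) :
    v (n + 1) / u (n + 1) - v n / u n = 1 / (r n * u n * u (n + 1)) := by
  have h1 := (huv.pos_u n).ne'
  have h2 := (huv.pos_u (n + 1)).ne'
  have h3 := huv.r_ne_zero n
  have h4 := huv.casoratian n
  field_simp
  linear_combination h4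

theorem strictMono_div (huv : IsPrincipalPair r q u v) (hr : ∀ n, 0 < r n) :
    StrictMono fun n => v n / u n := strictMono_nat_of_lt_succ fun n => by
  have h1 := huv.div_succ_sub_div n
  have := hr n
  have := huv.pos_u n
  have := huv.pos_u (n + 1)
  have h2 : 0 < 1 / (r n * u n * u (n + 1)) := by positivity
  linarith

theorem tendsto_div_atTop (huv : IsPrincipalPair r q u v) :
    Tendsto (fun n => v n / u n) atTop atTop := by
  have h1 : Tendsto (fun n => u n / v n) atTop (𝓝[>] 0) :=
    tendsto_nhdsWithin_iff.2 ⟨huv.tendsto_ratio,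
      Eventually.of_forall fun n => div_pos (huv.pos_u n) (huv.pos_v n)⟩
  exact h1.inv_tendsto_nhdsGT_zero.congr fun n => inv_div _ _

/-- The substitution `y = u w`. -/
theorem isSolution_mul (huv : IsPrincipalPair r q u v) {σ w g : ℕ → ℂ}
    (h : IsSystem (fun n => v n / u n) (fun n => σ n * (u n : ℂ) ^ 2) w g) :
    IsSolution (fun n => (r n : ℂ)) (fun n => (q n : ℂ) + σ n) (fun n => u n * w n) := by
  have hu : ∀ n, (u n : ℂ) ≠ 0 := fun n => Complex.ofReal_ne_zero.2 (huv.pos_u n).ne'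
  have hr : ∀ n, (r n : ℂ) ≠ 0 := fun n => Complex.ofReal_ne_zero.2 (huv.r_ne_zero n)
  -- Two forms of the flux `r Δ(u w)`: this one at `n` and the next at `n + 1` both carry the factor
  -- `w (n + 1)`, so their difference contains `Δ(r Δu) w`.
  have hflux : ∀ n, (r n : ℂ) * (u (n + 1) * w (n + 1) - u n * w n) =
      r n * (u (n + 1) - u n) * w (n + 1) + g n / u (n + 1) := fun n => by
    have h1 := h.step_fst n
    simp only [huv.div_succ_sub_div] at h1
    have := hu n
    have := hu (n + 1)
    have := hr n
    rw [h1]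
    push_cast
    field_simp
    ring
  have hflux' : ∀ n, (r n : ℂ) * (u (n + 1) * w (n + 1) - u n * w n) =
      r n * (u (n + 1) - u n) * w n + g n / u n := fun n => by
    have h1 := h.step_fst n
    simp only [huv.div_succ_sub_div] at h1
    have := hu n
    have := hu (n + 1)
    have := hr n
    rw [h1]
    push_cast
    field_simp
    ring
  intro n
  have h2 := huv.solution_u n
  simp only [fwdDiff] at h2 ⊢
  have h3 : (r (n + 1) : ℂ) * (u (n + 1 + 1) - u (n + 1)) - r n * (u (n + 1) - u n) =
      q (n + 1) * u (n + 1) := by exact_mod_cast h2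
  rw [hflux n, hflux' (n + 1), h.step_snd]
  have := hu (n + 1)
  field_simp
  linear_combination (u (n + 1) * w (n + 1)) * h3

end IsPrincipalPair

end HartmanWintner

/-! ### Assembly -/

theorem theorem1p1 (r q : ℕ → ℝ) (hr : ∀ n, 0 < r n) (σ : ℕ → ℂ)
    (u v : ℕ → ℝ) (huv : HartmanWintner.IsPrincipalPair r q u v)
    (hJ : HartmanWintner.ConvergesJ u v σ)
    (hAC : Summable (fun n : ℕ =>
      HartmanWintner.A u v σ (n + 1) * ‖HartmanWintner.C u v σ (n + 1)‖ /
        (r n * u n * v (n + 1)))) :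
    HartmanWintner.IsSolvable r q u v σ := by
  open Filter Topology Asymptotics HartmanWintner in
  set h : ℕ → ℝ := fun n => v n / u n with hh
  have hu : ∀ n, (u n : ℂ) ≠ 0 := fun n => Complex.ofReal_ne_zero.2 (huv.pos_u n).ne'
  have hv : ∀ n, (v n : ℂ) ≠ 0 := fun n => Complex.ofReal_ne_zero.2 (huv.pos_v n).ne'
  have hrC : ∀ n, (r n : ℂ) ≠ 0 := fun n => Complex.ofReal_ne_zero.2 (hr n).ne'
  have hpos : ∀ n, 0 < h n := fun n => div_pos (huv.pos_v n) (huv.pos_u n)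
  have hmono : StrictMono h := huv.strictMono_div hr
  have htop : Tendsto h atTop atTop := huv.tendsto_div_atTop
  -- `σ u² = (σ u v) / h`, with `1 / h` decreasing.
  obtain ⟨a, ha, hab⟩ := abel_summation (f := fun n => σ n * (u n : ℂ) ^ 2) (j := J u v σ)
    (c := fun n => (h n)⁻¹) (A := A u v σ)
    (fun m n hmn => inv_anti₀ (hpos m) (hmono.monotone hmn)) (fun n => (inv_pos.2 (hpos n)).le)
    (fun n => by
      have := hu n
      have := hv n
      simp only [hJ.J_succ, hh]
      push_cast
      field_simp) hJ.tendsto_J (fun n m => hJ.norm_J_le_A)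
  set S : ℕ → ℂ := fun n => a - ∑ k ∈ Finset.range n, σ k * (u k : ℂ) ^ 2 with hSdef
  have hCS : ∀ n, C u v σ n = h n * S n := fun n => by
    rw [C, tsum_conditional_tail (f := fun n => σ n * (u n : ℂ) ^ 2) ha]
    simp [hh, hSdef]
  have hsS : (fun n => S n - S (n + 1)) = fun n => σ n * (u n : ℂ) ^ 2 := by
    funext n
    simp only [hSdef, Finset.sum_range_succ]
    ring
  have hS : ∀ n, h n * ‖S n‖ ≤ 2 * A u v σ n := fun n => by
    have := mul_le_mul_of_nonneg_left (hab n) (hpos n).le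
    rwa [mul_comm (h n) (2 * _ * _), mul_assoc (2 * _), inv_mul_cancel₀ (hpos n).ne',
      mul_one] at this
  set T : ℕ → ℂ := fun n => J u v σ n - h n * S n with hTdef
  have hT : ∀ n, ‖T n‖ ≤ 3 * A u v σ n := fun n => by
    refine (norm_sub_le _ _).trans ?_
    rw [norm_mul, Complex.norm_real, Real.norm_of_nonneg (hpos n).le]
    linarith [hS n, hJ.norm_J_le_A (le_refl n)]
  have hST : ∀ n, T (n + 1) = T n - (h (n + 1) - h n : ℝ) * S (n + 1) := fun n => by
    have h1 := hJ.J_succ n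
    have h2 := congrFun hsS n
    have h3 : (h n : ℂ) * u n = v n := by
      have := hu n
      simp only [hh]
      push_cast
      field_simp
    simp only [hTdef]
    push_cast
    linear_combination -h1 + h n * h2 + σ n * u n * h3
  -- As `C = h S` and `h_{n+1} / (r_n u_n v_{n+1}) = Δh_n`, this is the hypothesis termwise.
  have hsum : Summable fun n => A u v σ (n + 1) * ‖S (n + 1)‖ * (h (n + 1) - h n) := by
    refine hAC.congr fun n => ?_
    rw [hCS, norm_mul, Complex.norm_real, Real.norm_of_nonneg (hpos _).le]
    have h1 : h (n + 1) - h n = 1 / (r n * u n * u (n + 1)) := huv.div_succ_sub_div n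
    have := huv.pos_u (n + 1)
    have := huv.pos_v (n + 1)
    rw [h1, hh]
    field_simp
  obtain ⟨w, g, hwg, hw, hg⟩ := IsSystem.exists_tendsto_one hpos hmono hST hT hS hJ.tendsto_A hsum
  obtain ⟨x, f, hxf, hx, hf⟩ := hwg.exists_tendsto_div hpos hmono htop hw hg
  rw [hsS] at hwg hxf
  have hU : Tendsto (fun n => u n * w n / u n) atTop (𝓝 1) :=
    hw.congr fun n => (mul_div_cancel_left₀ _ (hu n)).symm
  have hhC : ∀ n, (h n : ℂ) = v n / u n := fun n => by simp [hh]
  have hV : Tendsto (fun n => u n * x n / v n) atTop (𝓝 1) := hx.congr fun n => by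
    have := hu n
    have := hv n
    rw [hhC]
    field_simp
  have hdh : ∀ n, ((h (n + 1) - h n : ℝ) : ℂ) = 1 / (r n * u n * u (n + 1)) := fun n => by
    have h1 : h (n + 1) - h n = 1 / (r n * u n * u (n + 1)) := huv.div_succ_sub_div n
    rw [h1]
    push_cast
    rfl
  have hlo : ∀ {ψ F : ℕ → ℂ}, Tendsto ψ atTop (𝓝 0) →
      (∀ᶠ n in atTop, F n = (1 / (r n * u n * v n) : ℝ) * ψ n) →
      F =o[atTop] fun n => 1 / (r n * u n * v n) := fun {ψ F} hψ hF => by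
    have h1 : (fun n => ((1 / (r n * u n * v n) : ℝ) : ℂ) * ψ n) =o[atTop]
        fun n => 1 / (r n * u n * v n) * (1 : ℝ) :=
      IsBigO.mul_isLittleO (isBigO_of_le _ fun n => by rw [Complex.norm_real])
        ((isLittleO_one_iff ℝ).2 hψ)
    simp only [mul_one] at h1
    exact h1.congr' (hF.mono fun n hn => hn.symm) EventuallyEq.rfl
  refine ⟨fun n => u n * w n, fun n => u n * x n, ⟨huv.isSolution_mul hwg,
    huv.isSolution_mul hxf, ?_⟩, hU, hV, ?_, ?_⟩
  -- Different growth: dividing by `h` isolates `β`, then `w → 1` isolates `α`.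
  · rw [LinearIndependent.pair_iff]
    intro α β hαβ
    have hcomb : ∀ n, α * w n + β * x n = 0 := fun n => by
      have h1 : α * (u n * w n) + β * (u n * x n) = 0 := congrFun hαβ n
      refine (mul_eq_zero.1 (?_ : (u n : ℂ) * _ = 0)).resolve_left (hu n)
      linear_combination h1
    have hwh : Tendsto (fun n => w n / h n) atTop (𝓝 0) := by
      have h1 : Tendsto (fun n => ((h n)⁻¹ : ℝ)) atTop (𝓝 0) := tendsto_inv_atTop_zero.comp htop
      have h2 := hw.mul ((Complex.continuous_ofReal.tendsto 0).comp h1)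
      rw [Complex.ofReal_zero, mul_zero] at h2
      exact h2.congr fun n => by simp [div_eq_mul_inv]
    have hβ : β = 0 := by
      have h1 := (hwh.const_mul α).add (hx.const_mul β)
      have h2 : (fun n => α * (w n / h n) + β * (x n / h n)) = fun _ => 0 := by
        funext n
        rw [← mul_div_assoc, ← mul_div_assoc, ← add_div, hcomb, zero_div]
      rw [h2] at h1
      simpa using (tendsto_nhds_unique h1 tendsto_const_nhds)
    refine ⟨?_, hβ⟩
    have h1 := hw.const_mul α
    have h2 : (fun n => α * w n) = fun _ => 0 := by
      funext n
      simpa [hβ] using hcomb n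
    rw [h2] at h1
    simpa using (tendsto_nhds_unique h1 tendsto_const_nhds)
  -- The ratio difference is `h g / w` times `1 / (r u v)`.
  · have h1 := hg.div hw one_ne_zero
    rw [zero_div] at h1
    refine hlo h1 ((hw.eventually_ne one_ne_zero).mono fun n hn => ?_)
    have := hu n
    have := hv n
    have := hu (n + 1)
    have := hrC n
    simp only [Pi.div_apply]
    rw [hwg.step_fst, hdh, hhC]
    push_cast
    field_simp
    ring
  -- Here the factor is `f / (x / h) - 1`, from `v_{n+1} = u_{n+1} (h_n + Δh_n)`.
  · have h1 := (hf.div hx one_ne_zero).sub_const 1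
    rw [div_one, sub_self] at h1
    refine hlo h1 ((hx.eventually_ne one_ne_zero).mono fun n hn => ?_)
    have := hu n
    have := hv n
    have := hu (n + 1)
    have := hrC n
    have hxn : x n ≠ 0 := fun h0 => hn (by rw [h0, zero_div])
    have hvn : (v (n + 1) : ℂ) = u (n + 1) * (v n / u n + 1 / (r n * u n * u (n + 1))) := by
      rw [← hdh, ← hhC]
      push_cast
      rw [hhC (n + 1)]
      field_simp
      ring
    simp only [Pi.div_apply]
    rw [hxf.step_fst, hdh, hhC, hvn]
    push_cast
    field_simp
    ring
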